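/- Let $d\ge 1$, let $\Omega\subset\mathbb R^d$ be a bounded open set, $\nu>0$ and $a\in L^\infty(\Omega)$ (all functions are real valued). Fix Dirichlet or Neumann boundary conditions, written $\mathcal G y|_{\partial\Omega}=0$. Put $V=H^1_0(\Omega)$ in the Dirichlet case and $V=H^1(\Omega)$ in the Neumann case. Let $\mathcal A=-\nu\Delta+a$ be the operator in $L^2(\Omega)$ with domain $\mathrm D(\mathcal A)=\{z\in H^2(\Omega)\mid \mathcal G z|_{\partial\Omega}=0\}$, where $\mathcal G z|_{\partial\Omega}=0$ means $z\in H^1_0(\Omega)$ in the Dirichlet case, and means that the normal trace of $\nabla z$ vanishes, i.e. $\int_\Omega(\nabla z\cdot\nabla v+\Delta z\,v)\,dx=0$ for all $v\in H^1(\Omega)$, in the Neumann case. For $\Psi,y_0\in L^2(\Omega)$ and $u\in L^2_{\rm loc}((0,\infty),\mathbb R)$ consider the system $$\partial_t y-\nu\Delta y+a(x)y=u(t)\Psi(x)\quad(t>0),\qquad y(0)=y_0,\qquad \mathcal G y|_{\partial\Omega}=0. \tag{$*$}$$ A weak solution of $(*)$ is a function $y\in C([0,\infty),L^2(\Omega))\cap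 L^2_{\rm loc}((0,\infty),V)$ with $y(0)=y_0$ such that for all $v\in V$ and all $0<s\le t$ $$(y(t),v)_{L^2}-(y(s),v)_{L^2}+\int_s^t\bigl(\nu(\nabla y(r),\nabla v)_{L^2}+(a\,y(r),v)_{L^2}\bigr)\,dr=\int_s^t u(r)(\Psi,v)_{L^2}\,dr .$$ **Proposition.** Suppose that $\mathcal A$ has a nonsimple nonpositive eigenvalue $\alpha_j\le 0$, i.e. $\dim\ker(\mathcal A-\alpha_j)\ge 2$. Then for every $\Psi\in L^2(\Omega)$ the following hold. 1. There is an eigenfunction $0\ne y_0\in \mathrm D(\mathcal A)$, $\mathcal A y_0=\alpha_j y_0$, with $(y_0,\Psi)_{L^2(\Omega)}=0$, such that for every control $u\in L^2_{\rm loc}((0,\infty),\mathbb R)$ every weak solution $y$ of $(*)$ satisfies $$\|y(t)\|_{L^2(\Omega)}\ge e^{-\alpha_j t}\,\|y_0\|_{L^2(\Omega)}\qquad\text{for all }t\ge 0 .$$ 2. The static actuator $\Psi$ does not stabilize the system: it is not the case that for each initial state $y_0\in L^2(\Omega)$ there are a control $u\in L^2_{\rm loc}((0,\infty),\mathbb R)$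 and a weak solution $y$ of $(*)$ with $\|y(t)\|_{L^2(\Omega)}\to 0$ as $t\to\infty$. In particular the system is not exponentially stabilizable with $\Psi$. -/

import Mathlib

open MeasureTheory Filter Set Topology
open scoped ENNReal ContDiff

noncomputable section

namespace StaticActuator

/-- Real-valued `L²(Ω)` for the Lebesgue measure, `Ω ⊆ ℝᵈ`. -/
abbrev L2 {d : ℕ} (Ω : Set (EuclideanSpace ℝ (Fin d))) : Type :=
  Lp ℝ 2 (volume.restrict Ω)

/-- Real-valued `L^∞(Ω)`. -/
abbrev Linfty {d : ℕ} (Ω : Set (EuclideanSpace ℝ (Fin d))) : Type :=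
  Lp ℝ ∞ (volume.restrict Ω)

/-- `φ ∈ C_c^∞(Ω)`. -/
structure IsTestFunction {d : ℕ} (Ω : Set (EuclideanSpace ℝ (Fin d)))
    (φ : EuclideanSpace ℝ (Fin d) → ℝ) : Prop where
  smooth : ContDiff ℝ ∞ φ
  compact : HasCompactSupport φ
  subset : tsupport φ ⊆ Ω

/-- The classical partial derivative `∂ᵢφ`. -/
def partialDeriv {d : ℕ} (i : Fin d) (φ : EuclideanSpace ℝ (Fin d) → ℝ) :
    EuclideanSpace ℝ (Fin d) → ℝ :=
  fun x => fderiv ℝ φ x (EuclideanSpace.single i 1)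

/-- `g = ∂ᵢ f` in the weak sense on `Ω`. -/
def HasWeakPartial {d : ℕ} (Ω : Set (EuclideanSpace ℝ (Fin d))) (i : Fin d) (f g : L2 Ω) : Prop :=
  ∀ φ, IsTestFunction Ω φ →
    ∫ x in Ω, f x * partialDeriv i φ x = - ∫ x in Ω, g x * φ x

section Helpers

variable {d : ℕ} {Ω : Set (EuclideanSpace ℝ (Fin d))}

theorem IsTestFunction.memLp {φ : EuclideanSpace ℝ (Fin d) → ℝ} (h : IsTestFunction Ω φ) :
    MemLp φ 2 (volume.restrict Ω) :=
  (h.smooth.continuous.memLp_of_hasCompactSupport h.compact).restrict Ω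

theorem IsTestFunction.memLp_partialDeriv {φ : EuclideanSpace ℝ (Fin d) → ℝ}
    (h : IsTestFunction Ω φ) (i : Fin d) : MemLp (partialDeriv i φ) 2 (volume.restrict Ω) := by
  have hc : Continuous (partialDeriv i φ) :=
    (h.smooth.continuous_fderiv (by simp)).clm_apply continuous_const
  have hs : HasCompactSupport (partialDeriv i φ) := h.compact.fderiv_apply ℝ _
  exact (hc.memLp_of_hasCompactSupport hs).restrict Ω

theorem IsTestFunction.zero : IsTestFunction Ω (fun _ => (0 : ℝ)) :=
  ⟨contDiff_const, HasCompactSupport.zero, by simp [tsupport]⟩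

theorem IsTestFunction.add {φ ψ : EuclideanSpace ℝ (Fin d) → ℝ}
    (h : IsTestFunction Ω φ) (k : IsTestFunction Ω ψ) : IsTestFunction Ω (φ + ψ) :=
  ⟨h.smooth.add k.smooth, h.compact.add k.compact,
    (tsupport_add φ ψ).trans (union_subset h.subset k.subset)⟩

theorem IsTestFunction.smul {φ : EuclideanSpace ℝ (Fin d) → ℝ}
    (h : IsTestFunction Ω φ) (c : ℝ) : IsTestFunction Ω (c • φ) :=
  ⟨h.smooth.const_smul c, h.compact.smul_left (f := fun _ => c),
    (tsupport_smul_subset_right (fun _ => c) φ).trans h.subset⟩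

theorem partialDeriv_add {φ ψ : EuclideanSpace ℝ (Fin d) → ℝ} (i : Fin d)
    (h : IsTestFunction Ω φ) (k : IsTestFunction Ω ψ) :
    partialDeriv i (φ + ψ) = partialDeriv i φ + partialDeriv i ψ := by
  funext x
  simp [partialDeriv, fderiv_add (h.smooth.differentiable (by simp) x)
    (k.smooth.differentiable (by simp) x)]

theorem partialDeriv_smul {φ : EuclideanSpace ℝ (Fin d) → ℝ} (i : Fin d)
    (h : IsTestFunction Ω φ) (c : ℝ) :
    partialDeriv i (c • φ) = c • partialDeriv i φ := by
  funext x
  simp [partialDeriv, fderiv_const_smul (h.smooth.differentiable (by simp) x)]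

theorem HasWeakPartial.zero (i : Fin d) : HasWeakPartial Ω i 0 0 := by
  intro φ _
  have h0 : ∀ ψ : EuclideanSpace ℝ (Fin d) → ℝ,
      ∫ x in Ω, (0 : L2 Ω) x * ψ x = 0 := by
    intro ψ
    rw [integral_eq_zero_of_ae]
    filter_upwards [Lp.coeFn_zero ℝ 2 (volume.restrict Ω)] with x hx
    rw [hx, Pi.zero_apply, zero_mul]
  rw [h0, h0, neg_zero]

theorem integral_add_mul (f g : L2 Ω) {ψ : EuclideanSpace ℝ (Fin d) → ℝ}
    (hψ : MemLp ψ 2 (volume.restrict Ω)) :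
    ∫ x in Ω, (f + g : L2 Ω) x * ψ x = (∫ x in Ω, f x * ψ x) + ∫ x in Ω, g x * ψ x := by
  have hf : Integrable (fun x => f x * ψ x) (volume.restrict Ω) := (Lp.memLp f).integrable_mul hψ
  have hg : Integrable (fun x => g x * ψ x) (volume.restrict Ω) := (Lp.memLp g).integrable_mul hψ
  rw [← integral_add hf hg]
  refine integral_congr_ae ?_
  filter_upwards [Lp.coeFn_add f g] with x hx
  rw [hx, Pi.add_apply, add_mul]

theorem integral_smul_mul (c : ℝ) (f : L2 Ω) (ψ : EuclideanSpace ℝ (Fin d) → ℝ) :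
    ∫ x in Ω, (c • f : L2 Ω) x * ψ x = c * ∫ x in Ω, f x * ψ x := by
  rw [← integral_const_mul]
  refine integral_congr_ae ?_
  filter_upwards [Lp.coeFn_smul c f] with x hx
  rw [hx, Pi.smul_apply, smul_eq_mul, mul_assoc]

theorem HasWeakPartial.add {i : Fin d} {f g f' g' : L2 Ω} (h : HasWeakPartial Ω i f g)
    (h' : HasWeakPartial Ω i f' g') : HasWeakPartial Ω i (f + f') (g + g') := by
  intro φ hφ
  rw [integral_add_mul f f' (hφ.memLp_partialDeriv i), integral_add_mul g g' hφ.memLp,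
    h φ hφ, h' φ hφ]
  ring

theorem HasWeakPartial.smul {i : Fin d} {f g : L2 Ω} (c : ℝ) (h : HasWeakPartial Ω i f g) :
    HasWeakPartial Ω i (c • f) (c • g) := by
  intro φ hφ
  rw [integral_smul_mul, integral_smul_mul, h φ hφ]
  ring

/-- Weak derivatives on an open set are unique. -/
theorem HasWeakPartial.unique (hΩ : IsOpen Ω) {i : Fin d} {f g g' : L2 Ω}
    (h : HasWeakPartial Ω i f g) (h' : HasWeakPartial Ω i f g') : g = g' := by
  have hd : HasWeakPartial Ω i ((1 : ℝ) • f + (-1 : ℝ) • f) ((1 : ℝ) • g + (-1 : ℝ) • g') :=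
    (h.smul 1).add (h'.smul (-1))
  set k : L2 Ω := (1 : ℝ) • g + (-1 : ℝ) • g' with hk
  have hf : (1 : ℝ) • f + (-1 : ℝ) • f = 0 := by simp
  rw [hf] at hd
  have hloc : LocallyIntegrableOn k Ω volume := by
    rw [locallyIntegrableOn_iff hΩ.isLocallyClosed]
    intro K hK hKc
    have hkK : MemLp k 2 (volume.restrict K) :=
      (Lp.memLp k).mono_measure (Measure.restrict_mono hK le_rfl)
    have : IsFiniteMeasure (volume.restrict K) := ⟨by simpa using hKc.measure_lt_top⟩
    exact hkK.integrable (by norm_num)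
  have key : ∀ᵐ x ∂volume, x ∈ Ω → k x = 0 := by
    refine hΩ.ae_eq_zero_of_integral_contDiff_smul_eq_zero hloc ?_
    intro φ hs hc hsub
    have h1 := hd φ ⟨hs, hc, hsub⟩
    have h2 := HasWeakPartial.zero (Ω := Ω) i φ ⟨hs, hc, hsub⟩
    have h3 : ∫ x in Ω, (0 : L2 Ω) x * φ x = 0 := by
      rw [integral_eq_zero_of_ae]
      filter_upwards [Lp.coeFn_zero ℝ 2 (volume.restrict Ω)] with x hx
      rw [hx, Pi.zero_apply, zero_mul]
    have h4 : ∫ x in Ω, k x * φ x = 0 := by linarith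
    rw [← h4, setIntegral_eq_integral_of_forall_compl_eq_zero]
    · simp [mul_comm]
    · intro x hx
      rw [image_eq_zero_of_notMem_tsupport (fun hx' => hx (hsub hx')), mul_zero]
  have hk0 : k = 0 := by
    refine Lp.ext ?_
    filter_upwards [(ae_restrict_iff' hΩ.measurableSet).2 key,
      Lp.coeFn_zero ℝ 2 (volume.restrict Ω)] with x hx hx'
    rw [hx, hx', Pi.zero_apply]
  rw [hk] at hk0
  simpa [sub_eq_zero, ← sub_eq_add_neg] using hk0

end Helpers

/-- The Hilbert space `L²(Ω) × L²(Ω)ᵈ`, in which `H¹(Ω)` is realised by `f ↦ (f, ∇f)`. -/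
abbrev GradSpace {d : ℕ} (Ω : Set (EuclideanSpace ℝ (Fin d))) : Type :=
  WithLp 2 (L2 Ω × PiLp 2 (fun _ : Fin d => L2 Ω))

/-- The function `f` of a pair `(f, ∇f)`. -/
abbrev val {d : ℕ} {Ω : Set (EuclideanSpace ℝ (Fin d))} (p : GradSpace Ω) : L2 Ω := p.fst

/-- The gradient `∇f` of a pair `(f, ∇f)`. -/
abbrev grad {d : ℕ} {Ω : Set (EuclideanSpace ℝ (Fin d))} (p : GradSpace Ω) :
    PiLp 2 (fun _ : Fin d => L2 Ω) := p.snd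

/-- The Sobolev space `H¹(Ω)`: the pairs `(f, ∇f)` with `f ∈ L²(Ω)` whose weak gradient `∇f`
lies in `L²(Ω)ᵈ`.  The inherited norm is the usual `H¹` norm. -/
def H1 {d : ℕ} (Ω : Set (EuclideanSpace ℝ (Fin d))) : Submodule ℝ (GradSpace Ω) where
  carrier := {p | ∀ i, HasWeakPartial Ω i (val p) (grad p i)}
  add_mem' := fun hp hq i => (hp i).add (hq i)
  zero_mem' := fun i => HasWeakPartial.zero i
  smul_mem' := fun c _ hp i => (hp i).smul c

/-- The pairs `(φ, ∇φ)` with `φ ∈ C_c^∞(Ω)`. -/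
def testPairs {d : ℕ} (Ω : Set (EuclideanSpace ℝ (Fin d))) : Submodule ℝ (GradSpace Ω) where
  carrier := {p | ∃ φ, IsTestFunction Ω φ ∧ val p =ᵐ[volume.restrict Ω] φ ∧
    ∀ i, grad p i =ᵐ[volume.restrict Ω] partialDeriv i φ}
  add_mem' := by
    rintro p q ⟨φ, hφ, hp, hp'⟩ ⟨ψ, hψ, hq, hq'⟩
    refine ⟨φ + ψ, hφ.add hψ, (Lp.coeFn_add (val p) (val q)).trans (hp.add hq), fun i => ?_⟩
    rw [partialDeriv_add i hφ hψ]
    exact (Lp.coeFn_add (grad p i) (grad q i)).trans ((hp' i).add (hq' i))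
  zero_mem' := by
    refine ⟨fun _ => 0, IsTestFunction.zero, Lp.coeFn_zero ℝ 2 _, fun i => ?_⟩
    have : partialDeriv i (fun _ : EuclideanSpace ℝ (Fin d) => (0 : ℝ)) = 0 := by
      funext x
      simp [partialDeriv]
    rw [this]
    exact Lp.coeFn_zero ℝ 2 _
  smul_mem' := by
    rintro c p ⟨φ, hφ, hp, hp'⟩
    refine ⟨c • φ, hφ.smul c, (Lp.coeFn_smul c (val p)).trans (hp.const_smul c), fun i => ?_⟩
    rw [partialDeriv_smul i hφ c]
    exact (Lp.coeFn_smul c (grad p i)).trans ((hp' i).const_smul c)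

/-- `H¹₀(Ω)`, the `H¹`-closure of `C_c^∞(Ω)`: the functions with vanishing Dirichlet trace. -/
def H10 {d : ℕ} (Ω : Set (EuclideanSpace ℝ (Fin d))) : Submodule ℝ (GradSpace Ω) :=
  (testPairs Ω).topologicalClosure

/-- The two choices for the trace operator `𝒢` of the boundary condition `𝒢 y = 0` on `∂Ω`. -/
inductive BoundaryCondition where
  | dirichlet
  | neumann

/-- The energy space `V`: `H¹₀(Ω)` for Dirichlet conditions, `H¹(Ω)` for Neumann conditions. -/
def energySpace {d : ℕ} (Ω : Set (EuclideanSpace ℝ (Fin d))) :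
    BoundaryCondition → Submodule ℝ (GradSpace Ω)
  | .dirichlet => H10 Ω
  | .neumann => H1 Ω

/-- `𝒢 z = 0` on `∂Ω` for `z ∈ H²(Ω)`, given as the pair `p = (z, ∇z)` with `Δz = lap`.
Dirichlet: `z ∈ H¹₀(Ω)`.  Neumann: the normal trace `n · ∇z`, which by Green's formula is the
functional `v ↦ ∫_Ω (∇z · ∇v + Δz v)` on `H¹(Ω)`, vanishes. -/
def TraceVanishes {d : ℕ} (Ω : Set (EuclideanSpace ℝ (Fin d))) :
    BoundaryCondition → GradSpace Ω → L2 Ω → Prop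
  | .dirichlet, p, _ => p ∈ H10 Ω
  | .neumann, p, lap => ∀ v ∈ H1 Ω, inner ℝ (grad p) (grad v) + inner ℝ lap (val v) = 0

/-- `z ∈ H²(Ω)` with `𝒢 z = 0`, and `Δz = lap`: here `p = (z, ∇z) ∈ H¹(Ω)`, all the
second weak derivatives `D i j = ∂ⱼ∂ᵢ z` exist in `L²(Ω)`, and `lap = ∑ᵢ D i i`. -/
def IsH2WithBC {d : ℕ} (Ω : Set (EuclideanSpace ℝ (Fin d))) (bc : BoundaryCondition)
    (z lap : L2 Ω) : Prop :=
  ∃ p ∈ H1 Ω, val p = z ∧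
    ∃ D : Fin d → Fin d → L2 Ω, (∀ i j, HasWeakPartial Ω j (grad p i) (D i j)) ∧
      lap = ∑ i, D i i ∧ TraceVanishes Ω bc p lap

section Helpers

variable {d : ℕ} {Ω : Set (EuclideanSpace ℝ (Fin d))} {bc : BoundaryCondition}

theorem IsH2WithBC.zero : IsH2WithBC Ω bc 0 0 := by
  refine ⟨0, Submodule.zero_mem _, rfl, fun _ _ => 0, fun i j => HasWeakPartial.zero j,
    by simp, ?_⟩
  cases bc with
  | dirichlet => exact Submodule.zero_mem _
  | neumann => intro v _; simp [grad]

theorem IsH2WithBC.add {z z' l l' : L2 Ω} (h : IsH2WithBC Ω bc z l)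
    (h' : IsH2WithBC Ω bc z' l') : IsH2WithBC Ω bc (z + z') (l + l') := by
  obtain ⟨p, hp, rfl, D, hD, hl, hb⟩ := h
  obtain ⟨q, hq, rfl, D', hD', hl', hb'⟩ := h'
  refine ⟨p + q, Submodule.add_mem _ hp hq, rfl, fun i j => D i j + D' i j,
    fun i j => (hD i j).add (hD' i j), by simp [hl, hl', Finset.sum_add_distrib], ?_⟩
  cases bc with
  | dirichlet => exact Submodule.add_mem _ hb hb'
  | neumann =>
    intro v hv
    have e : grad (p + q) = grad p + grad q := rfl
    rw [e, inner_add_left, inner_add_left]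
    linarith [hb v hv, hb' v hv]

theorem IsH2WithBC.smul {z l : L2 Ω} (c : ℝ) (h : IsH2WithBC Ω bc z l) :
    IsH2WithBC Ω bc (c • z) (c • l) := by
  obtain ⟨p, hp, rfl, D, hD, hl, hb⟩ := h
  refine ⟨c • p, Submodule.smul_mem _ c hp, rfl, fun i j => c • D i j,
    fun i j => (hD i j).smul c, by simp [hl, Finset.smul_sum], ?_⟩
  cases bc with
  | dirichlet => exact Submodule.smul_mem _ c hb
  | neumann =>
    intro v hv
    have e : grad (c • p) = c • grad p := rfl
    rw [e, real_inner_smul_left, real_inner_smul_left, ← mul_add, hb v hv, mul_zero]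

theorem IsH2WithBC.unique (hΩ : IsOpen Ω) {z l l' : L2 Ω} (h : IsH2WithBC Ω bc z l)
    (h' : IsH2WithBC Ω bc z l') : l = l' := by
  obtain ⟨p, hp, hpz, D, hD, hl, -⟩ := h
  obtain ⟨q, hq, hqz, D', hD', hl', -⟩ := h'
  rw [hl, hl']
  refine Finset.sum_congr rfl fun i _ => ?_
  have e : grad p i = grad q i := by
    have h1 := hp i
    have h2 := hq i
    rw [hpz] at h1
    rw [hqz] at h2
    exact h1.unique hΩ h2
  have h1 := hD i i
  rw [e] at h1
  exact h1.unique hΩ (hD' i i)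

theorem Linfty_smul_add (a : Linfty Ω) (f g : L2 Ω) :
    (a • (f + g) : L2 Ω) = (a • f : L2 Ω) + (a • g : L2 Ω) := Lp.add_smul a f g

theorem Linfty_smul_smul (a : Linfty Ω) (c : ℝ) (f : L2 Ω) :
    (a • (c • f) : L2 Ω) = c • (a • f : L2 Ω) := (Lp.smul_comm c a f).symm

end Helpers

/-- The graph of `𝒜 z = -ν Δz + a z` with domain `{z ∈ H²(Ω) | 𝒢 z = 0 on ∂Ω}`. -/
def operatorGraph {d : ℕ} (Ω : Set (EuclideanSpace ℝ (Fin d))) (bc : BoundaryCondition) (ν : ℝ)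
    (a : Linfty Ω) : Submodule ℝ (L2 Ω × L2 Ω) where
  carrier := {q | ∃ lap : L2 Ω, IsH2WithBC Ω bc q.1 lap ∧ q.2 = -(ν • lap) + (a • q.1 : L2 Ω)}
  add_mem' := by
    rintro ⟨z, w⟩ ⟨z', w'⟩ ⟨l, h, e⟩ ⟨l', h', e'⟩
    refine ⟨l + l', h.add h', ?_⟩
    simp only at e e'
    simp only [Prod.mk_add_mk, e, e', Linfty_smul_add, smul_add]
    abel
  zero_mem' := ⟨0, IsH2WithBC.zero, by simp⟩
  smul_mem' := by
    rintro c ⟨z, w⟩ ⟨l, h, e⟩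
    refine ⟨c • l, h.smul c, ?_⟩
    simp only at e
    simp only [Prod.smul_mk, e, Linfty_smul_smul, smul_add, smul_neg, smul_comm ν c]

/-- The unbounded operator `𝒜 = -ν Δ + a` in `L²(Ω)`, with domain
`{z ∈ H²(Ω) | 𝒢 z = 0 on ∂Ω}`. -/
def operator {d : ℕ} (Ω : Set (EuclideanSpace ℝ (Fin d))) (bc : BoundaryCondition) (ν : ℝ)
    (a : Linfty Ω) : L2 Ω →ₗ.[ℝ] L2 Ω :=
  (operatorGraph Ω bc ν a).toLinearPMap

theorem operator_graph {d : ℕ} {Ω : Set (EuclideanSpace ℝ (Fin d))} (hΩ : IsOpen Ω)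
    (bc : BoundaryCondition) (ν : ℝ) (a : Linfty Ω) :
    (operator Ω bc ν a).graph = operatorGraph Ω bc ν a := by
  refine Submodule.toLinearPMap_graph_eq _ ?_
  rintro ⟨z, w⟩ ⟨l, h, e⟩ hz
  simp only at h e hz
  subst hz
  have hl : l = 0 := h.unique hΩ IsH2WithBC.zero
  simp only [e, hl, smul_zero, neg_zero, zero_add]
  exact Lp.smul_zero ℝ 2 a

/-- The eigenspace `{z ∈ D(A) | A z = α z}` of an unbounded operator `A`. -/
def eigenspace {H : Type*} [AddCommGroup H] [Module ℝ H] (A : H →ₗ.[ℝ] H) (α : ℝ) :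
    Submodule ℝ H where
  carrier := {z | ∃ hz : z ∈ A.domain, A ⟨z, hz⟩ = α • z}
  add_mem' := by
    rintro z w ⟨hz, ez⟩ ⟨hw, ew⟩
    refine ⟨A.domain.add_mem hz hw, ?_⟩
    rw [smul_add, ← ez, ← ew, ← A.map_add]
    rfl
  zero_mem' := ⟨A.domain.zero_mem, by rw [smul_zero]; exact A.map_zero⟩
  smul_mem' := by
    rintro c z ⟨hz, ez⟩
    refine ⟨A.domain.smul_mem c hz, ?_⟩
    rw [smul_comm, ← ez, ← A.map_smul]
    rfl

/-- `α` is a nonsimple eigenvalue of `A`: there are at least two linearly independent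
eigenvectors for `α`. -/
def IsNonsimpleEigenvalue {H : Type*} [AddCommGroup H] [Module ℝ H] (A : H →ₗ.[ℝ] H) (α : ℝ) :
    Prop :=
  2 ≤ Module.rank ℝ (eigenspace A α)

/-- `f ∈ L²_loc((0,∞), X)`. -/
def IsL2Loc {X : Type*} [NormedAddCommGroup X] (f : ℝ → X) : Prop :=
  ∀ s t : ℝ, 0 < s → MemLp f 2 (volume.restrict (Icc s t))

/-- `y` is a weak solution on `[0,∞)` of `∂ₜ y - ν Δ y + a y = u(t) Ψ`, `y(0) = y₀`, `𝒢 y = 0` on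
`∂Ω`: one has `y ∈ C([0,∞), L²(Ω)) ∩ L²_loc((0,∞), V)` with `V` the energy space, `y(0) = y₀`, and
`d/dt (y, v) + ν (∇y, ∇v) + (a y, v) = u (Ψ, v)` for every `v ∈ V`, in time-integrated form.
`Y t` is `y t` regarded as an element of `V`, for almost every `t > 0`. -/
structure IsWeakSolution {d : ℕ} (Ω : Set (EuclideanSpace ℝ (Fin d))) (bc : BoundaryCondition)
    (ν : ℝ) (a : Linfty Ω) (Ψ : L2 Ω) (u : ℝ → ℝ) (y₀ : L2 Ω) (y : ℝ → L2 Ω) : Prop where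
  continuousOn : ContinuousOn y (Ici 0)
  initial : y 0 = y₀
  weak_eq : ∃ Y : ℝ → energySpace Ω bc, IsL2Loc Y ∧
    (∀ᵐ t ∂(volume.restrict (Ioi (0 : ℝ))), y t = val (Y t : GradSpace Ω)) ∧
    ∀ v ∈ energySpace Ω bc, ∀ s t : ℝ, 0 < s → s ≤ t →
      inner ℝ (y t) (val v) - inner ℝ (y s) (val v)
        + ∫ r in s..t, (ν * inner ℝ (grad (Y r : GradSpace Ω)) (grad v)
            + inner ℝ (a • val (Y r : GradSpace Ω) : L2 Ω) (val v))
      = ∫ r in s..t, u r * inner ℝ Ψ (val v)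

/-- The static actuator `Ψ` stabilizes the system: every initial state admits a control
`u ∈ L²_loc` for which a weak solution tends to `0` in `L²(Ω)` (at whatever rate). -/
def IsStabilizing {d : ℕ} (Ω : Set (EuclideanSpace ℝ (Fin d))) (bc : BoundaryCondition)
    (ν : ℝ) (a : Linfty Ω) (Ψ : L2 Ω) : Prop :=
  ∀ y₀ : L2 Ω, ∃ u : ℝ → ℝ, IsL2Loc u ∧ ∃ y : ℝ → L2 Ω,
    IsWeakSolution Ω bc ν a Ψ u y₀ y ∧ Tendsto (fun t => ‖y t‖) atTop (𝓝 0)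

end StaticActuator

end

open MeasureTheory Filter Set Topology
open scoped ENNReal ContDiff

namespace StaticActuator

variable {d : ℕ} {Ω : Set (EuclideanSpace ℝ (Fin d))}

/-! Orthogonality to `Ψ` is a single linear condition, so an eigenspace of dimension at least two
contains some `y₀ ≠ 0` orthogonal to `Ψ` (`exists_ne_zero_inner_eq_zero`). Testing the weak equation
with `y₀` itself removes the control. Because the bilinear form is symmetric and `y₀` satisfies the
weak eigenvalue equation (`exists_weak_eigenpair`), the scalar `m t = (y t, y₀)` obeys `m' = -α m`
whatever `u` is, hence `m t = exp (-α t) ‖y₀‖²` (`eq_exp_mul_of_integral_eq`). Cauchy–Schwarz turns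
this into the lower bound on `‖y t‖`, and for `α ≤ 0` that bound never drops below `‖y₀‖`, which
excludes decay.

The only place where the boundary conditions differ is Green's formula: in the Neumann case it is
the vanishing of the normal trace, in the Dirichlet case it follows by density of test functions. -/

/-- Multiplication by a bounded function is symmetric in `L²`. -/
theorem inner_Linfty_smul_comm (a : Linfty Ω) (f g : L2 Ω) :
    inner ℝ (a • f : L2 Ω) g = inner ℝ f (a • g : L2 Ω) := by
  rw [L2.inner_def, L2.inner_def]
  refine integral_congr_ae ?_
  filter_upwards [Lp.coeFn_lpSMul (r := 2) a f, Lp.coeFn_lpSMul (r := 2) a g] with x hf hg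
  rw [hf, hg]
  simp only [Pi.smul_apply', smul_eq_mul, RCLike.inner_apply, conj_trivial]
  ring

theorem inner_eq_integral_of_ae_eq (f g : L2 Ω) {φ : EuclideanSpace ℝ (Fin d) → ℝ}
    (h : g =ᵐ[volume.restrict Ω] φ) : inner ℝ f g = ∫ x in Ω, f x * φ x := by
  rw [L2.inner_def]
  refine integral_congr_ae ?_
  filter_upwards [h] with x hx
  rw [hx, RCLike.inner_apply, conj_trivial, mul_comm]

/-! ### Green's formula and the weak eigenvalue problem -/

/-- Green's formula for `z ∈ H²(Ω)` and `v ∈ H¹₀(Ω)`. -/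
theorem inner_grad_add_inner_lap_eq_zero {p : GradSpace Ω} {D : Fin d → Fin d → L2 Ω}
    (hD : ∀ i j, HasWeakPartial Ω j (grad p i) (D i j)) {v : GradSpace Ω} (hv : v ∈ H10 Ω) :
    inner ℝ (grad p) (grad v) + inner ℝ (∑ i, D i i) (val v) = 0 := by
  -- Both terms are continuous in the `H¹` norm, so test functions suffice; for them the identity
  -- is, index by index, the definition of the weak derivative `D i i`.
  have hclosed : IsClosed {w : GradSpace Ω |
      inner ℝ (grad p) (grad w) + inner ℝ (∑ i, D i i) (val w) = 0} := by
    refine isClosed_eq ?_ continuous_const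
    exact (continuous_const.inner (WithLp.sndL 2 ℝ _ _).continuous).add
      (continuous_const.inner (WithLp.fstL 2 ℝ _ _).continuous)
  refine closure_minimal ?_ hclosed hv
  rintro w ⟨φ, hφ, hw, hw'⟩
  rw [mem_ofPred_eq, PiLp.inner_apply, sum_inner, ← Finset.sum_add_distrib]
  refine Finset.sum_eq_zero fun i _ => ?_
  rw [inner_eq_integral_of_ae_eq _ _ (hw' i), inner_eq_integral_of_ae_eq _ _ hw, hD i i φ hφ,
    neg_add_cancel]

/-- The strong formulation implies the weak formulation of the eigenvalue problem. -/
theorem exists_weak_eigenpair (hΩ : IsOpen Ω) {bc : BoundaryCondition} {ν : ℝ} {a : Linfty Ω}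
    {α : ℝ} {z : L2 Ω} (hz : z ∈ eigenspace (operator Ω bc ν a) α) :
    ∃ p ∈ energySpace Ω bc, val p = z ∧ ∀ w ∈ energySpace Ω bc,
      ν * inner ℝ (grad w) (grad p) + inner ℝ (a • val w : L2 Ω) (val p)
        = α * inner ℝ (val w) (val p) := by
  obtain ⟨hdom, heig⟩ := hz
  -- Passing to the graph recovers the Laplacian that underlies the value of the operator.
  have hgraph : (z, α • z) ∈ operatorGraph Ω bc ν a := by
    rw [← operator_graph hΩ, ← heig]
    exact (operator Ω bc ν a).mem_graph ⟨z, hdom⟩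
  obtain ⟨lap, ⟨p, hp, hpz, D, hD, hlap, htrace⟩, heq⟩ := hgraph
  simp only at hpz heq
  have hgreen : ∀ w ∈ energySpace Ω bc,
      inner ℝ (grad p) (grad w) + inner ℝ lap (val w) = 0 := by
    intro w hw
    cases bc with
    | dirichlet =>
      rw [hlap]
      exact inner_grad_add_inner_lap_eq_zero hD hw
    | neumann => exact htrace w hw
  refine ⟨p, ?_, hpz, fun w hw => ?_⟩
  · cases bc with
    | dirichlet => exact htrace
    | neumann => exact hp
  · have h := congrArg (fun f : L2 Ω => inner ℝ (val w) f) heq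
    simp only [inner_add_right, inner_neg_right, real_inner_smul_right] at h
    rw [inner_Linfty_smul_comm, hpz, real_inner_comm (grad p) (grad w),
      eq_neg_of_add_eq_zero_left (hgreen w hw), h, real_inner_comm lap (val w)]
    ring

/-! ### The scalar equation along an eigenfunction -/

/-- A continuous solution of `m' = -α m` in integrated form is `exp (-α t) m(0)`. -/
theorem eq_exp_mul_of_integral_eq {m : ℝ → ℝ} {α : ℝ} (hm : ContinuousOn m (Ici 0))
    (h : ∀ s t : ℝ, 0 < s → s ≤ t → m t - m s + α * ∫ r in s..t, m r = 0)
    {t : ℝ} (ht : 0 ≤ t) : m t = Real.exp (-α * t) * m 0 := by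
  have hderiv : ∀ x : ℝ, 0 < x → HasDerivAt m (-α * m x) x := by
    intro x hx
    -- The integral identity is available only from positive times; the base point `x / 2` is
    -- positive and leaves `x` in the interior.
    have hs : 0 < x / 2 := by positivity
    have hcont : ContinuousOn m (Ioi 0) := hm.mono Ioi_subset_Ici_self
    have hint : IntervalIntegrable m volume (x / 2) x := by
      refine (hm.mono ?_).intervalIntegrable
      rw [uIcc_of_le (by linarith)]
      exact fun r hr => hs.le.trans hr.1
    have hd : HasDerivAt (fun t => ∫ r in (x / 2)..t, m r) (m x) x :=
      intervalIntegral.integral_hasDerivAt_right hint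
        (hcont.stronglyMeasurableAtFilter isOpen_Ioi x hx) (hcont.continuousAt (Ioi_mem_nhds hx))
    refine ((hd.const_mul (-α)).const_add (m (x / 2))).congr_of_eventuallyEq ?_
    filter_upwards [Ioi_mem_nhds (show x / 2 < x by linarith)] with r hr
    linarith [h (x / 2) r hs (le_of_lt hr)]
  rcases ht.eq_or_lt with rfl | ht
  · simp
  -- Mean value theorem for `exp (α x) m x`, whose derivative vanishes on `(0, t)`. Continuity of
  -- `m` at `0` is what reaches the initial value.
  obtain ⟨c, -, hc⟩ := exists_hasDerivAt_eq_slope (fun x => Real.exp (α * x) * m x)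
    (fun _ => 0) ht
    ((by fun_prop : Continuous fun x : ℝ => Real.exp (α * x)).continuousOn.mul
      (hm.mono Icc_subset_Ici_self)) (fun x hx => by
      have he : HasDerivAt (fun x : ℝ => Real.exp (α * x)) (Real.exp (α * x) * (α * 1)) x :=
        ((hasDerivAt_id x).const_mul α).exp
      exact (he.mul (hderiv x hx.1)).congr_deriv (by ring))
  have hc' : Real.exp (α * t) * m t = m 0 := by
    rw [eq_div_iff (by linarith)] at hc
    simp only [mul_zero, Real.exp_zero, zero_mul, one_mul] at hc
    linarith
  rw [← hc', ← mul_assoc, ← Real.exp_add]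
  simp

/-- A weak solution has the same component along an eigenfunction orthogonal to the actuator as
the free dynamics. -/
theorem IsWeakSolution.inner_eigenfunction (hΩ : IsOpen Ω) {bc : BoundaryCondition} {ν : ℝ}
    {a : Linfty Ω} {α : ℝ} {z Ψ : L2 Ω} (hz : z ∈ eigenspace (operator Ω bc ν a) α)
    (horth : inner ℝ z Ψ = 0) {u : ℝ → ℝ} {y₀ : L2 Ω} {y : ℝ → L2 Ω}
    (hy : IsWeakSolution Ω bc ν a Ψ u y₀ y) {t : ℝ} (ht : 0 ≤ t) :
    inner ℝ (y t) z = Real.exp (-α * t) * inner ℝ y₀ z := by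
  obtain ⟨p, hp, rfl, hweak⟩ := exists_weak_eigenpair hΩ hz
  obtain ⟨Y, -, hYy, heq⟩ := hy.weak_eq
  rw [← hy.initial]
  refine eq_exp_mul_of_integral_eq (m := fun t => inner ℝ (y t) (val p))
    (hy.continuousOn.inner continuousOn_const) (fun s t hs hst => ?_) ht
  have hst' := heq p hp s t hs hst
  simp only [real_inner_comm (val p) Ψ, horth, mul_zero, intervalIntegral.integral_zero] at hst'
  rw [← hst', ← intervalIntegral.integral_const_mul]
  congr 1
  refine intervalIntegral.integral_congr_ae ?_
  -- `y r` agrees with its representative `Y r` in `V` only for almost every `r > 0`, which is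
  -- enough under the integral.
  filter_upwards [(ae_restrict_iff' measurableSet_Ioi).1 hYy] with r hr hrst
  rw [uIoc_of_le hst] at hrst
  rw [hweak _ (Y r).2, hr (hs.trans hrst.1)]

/-- A space of dimension at least two contains a nonzero vector orthogonal to a given one. -/
theorem exists_ne_zero_inner_eq_zero {H : Type*} [NormedAddCommGroup H] [InnerProductSpace ℝ H]
    {E : Submodule ℝ H} (hE : 2 ≤ Module.rank ℝ E) (x : H) :
    ∃ z ∈ E, z ≠ 0 ∧ inner ℝ z x = 0 := by
  by_contra! hcon
  -- Without such a vector, pairing with `x` would embed `E` linearly into `ℝ`, forcing rank at most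
  -- one.
  have hinj : Function.Injective ((innerₛₗ ℝ x).comp E.subtype) := by
    rw [← LinearMap.ker_eq_bot, LinearMap.ker_eq_bot']
    intro z hz
    by_contra hne
    refine hcon z z.2 (fun h => hne (Subtype.ext h)) ?_
    rw [real_inner_comm]
    exact hz
  have hrank := LinearMap.lift_rank_le_of_injective _ hinj
  rw [Module.rank_self, Cardinal.lift_one, Cardinal.lift_uzero] at hrank
  exact absurd (hE.trans hrank) (by norm_num)

end StaticActuator

theorem proposition1p2 {d : ℕ} (hd : 1 ≤ d) (Ω : Set (EuclideanSpace ℝ (Fin d)))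
    (hΩ : IsOpen Ω) (hΩb : Bornology.IsBounded Ω) (bc : StaticActuator.BoundaryCondition)
    (ν : ℝ) (hν : 0 < ν) (a : StaticActuator.Linfty Ω) (α : ℝ) (hα : α ≤ 0)
    (hmult : StaticActuator.IsNonsimpleEigenvalue (StaticActuator.operator Ω bc ν a) α)
    (Ψ : StaticActuator.L2 Ω) :
    (∃ y₀ : StaticActuator.L2 Ω,
      y₀ ≠ 0 ∧
      (∃ h : y₀ ∈ (StaticActuator.operator Ω bc ν a).domain,
        StaticActuator.operator Ω bc ν a ⟨y₀, h⟩ = α • y₀) ∧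
      inner ℝ y₀ Ψ = 0 ∧
      ∀ u : ℝ → ℝ, StaticActuator.IsL2Loc u →
        ∀ y : ℝ → StaticActuator.L2 Ω, StaticActuator.IsWeakSolution Ω bc ν a Ψ u y₀ y →
          ∀ t : ℝ, 0 ≤ t → Real.exp (-α * t) * ‖y₀‖ ≤ ‖y t‖) ∧
    ¬ StaticActuator.IsStabilizing Ω bc ν a Ψ := by
  obtain ⟨y₀, hmem, hne, horth⟩ := StaticActuator.exists_ne_zero_inner_eq_zero hmult Ψ
  have hpos : 0 < ‖y₀‖ := norm_pos_iff.2 hne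
  have hbound : ∀ (u : ℝ → ℝ) (y : ℝ → StaticActuator.L2 Ω),
      StaticActuator.IsWeakSolution Ω bc ν a Ψ u y₀ y →
        ∀ t : ℝ, 0 ≤ t → Real.exp (-α * t) * ‖y₀‖ ≤ ‖y t‖ := by
    intro u y hy t ht
    -- Cauchy–Schwarz against `y₀`; one factor `‖y₀‖ > 0` then cancels.
    have h := real_inner_le_norm (y t) y₀
    rw [hy.inner_eigenfunction hΩ hmem horth ht, real_inner_self_eq_norm_mul_norm,
      ← mul_assoc] at h
    exact le_of_mul_le_mul_right h hpos
  refine ⟨⟨y₀, hne, hmem, horth, fun u _ => hbound u⟩, fun hstab => ?_⟩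
  obtain ⟨u, -, y, hy, hlim⟩ := hstab y₀
  -- A limit `0` would give `‖y₀‖ ≤ 0`. The sign of `α` enters only here, through `1 ≤ exp (-α t)`.
  refine hpos.not_ge (ge_of_tendsto hlim ?_)
  filter_upwards [eventually_ge_atTop 0] with t ht
  refine le_trans (le_mul_of_one_le_left hpos.le (Real.one_le_exp ?_)) (hbound u y hy t ht)
  exact mul_nonneg (neg_nonneg.2 hα) ht
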